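/- **Theorem (Law of the Iterated Logarithm, effective form).** Let $2^{\mathbb N}$ be the set of infinite binary sequences with the fair-coin measure $\mu$, i.e. the Borel measure with $\mu(\{X : X \text{ extends } \sigma\}) = 2^{-|\sigma|}$ for every bitstring $\sigma$. A sequence $(V_n)_{n\in\mathbb N}$ of subsets of $2^{\mathbb N}$ is *uniformly $\Sigma^0_1$* if there is an oracle program such that, for all $n$ and $X$, $X \in V_n$ if and only if the program with oracle $X$ halts on input $n$. A set $S \subseteq 2^{\mathbb N}$ is *effectively null* if $S \subseteq \bigcap_n V_n$ for some uniformly $\Sigma^0_1$ sequence with $\mu(V_n) \le 2^{-n}$ for all $n$. A sequence $X$ is *Martin-Löf random* if it lies in no effectively null set. Let $X \in 2^{\mathbb N}$ be Martin-Löf random and let $S_n = \sum_{i=0}^{n-1} X(i)$. Then (the expressions below being considered for $n \ge 3$) $$\limsup_{n\to\infty} \frac{S_n - \frac n2}{\sqrt{\frac n2 \log\log n}} = 1.$$ That is: 1. for every real $\lambda > 1$ there is an $N$ such that $S_n \le \frac n2 + \lambda\sqrt{\frac n2\log\log n}$ for all $n > N$; 2. for every real $\lambda < 1$ there are infinitely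 many $n$ with $S_n > \frac n2 + \lambda\sqrt{\frac n2\log\log n}$. Moreover, the sequence $\neg X$ obtained from $X$ by flipping every bit is Martin-Löf random, and $$\liminf_{n\to\infty} \frac{S_n - \frac n2}{\sqrt{\frac n2 \log\log n}} = -1, \qquad \limsup_{n\to\infty} \frac{\left|S_n - \frac n2\right|}{\sqrt{\frac n2 \log\log n}} = 1.$$ -/

import Mathlib

open Filter MeasureTheory
open scoped ENNReal

/-- The uniform (fair coin) measure on Cantor space `ℕ → Bool`: the product of fair coin measures,
which gives the set of all extensions of a bitstring of length `k` the measure `2⁻ᵏ`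
(see `fairCoinMeasure_cylinder`). -/
noncomputable def fairCoinMeasure : Measure (ℕ → Bool) :=
  Measure.infinitePi fun _ : ℕ => (PMF.uniformOfFintype Bool).toMeasure

theorem fairCoinMeasure_cylinder (k : ℕ) (s : ℕ → Bool) :
    fairCoinMeasure {X : ℕ → Bool | ∀ i < k, X i = s i} = (2⁻¹ : ℝ≥0∞) ^ k := by
  have h : {X : ℕ → Bool | ∀ i < k, X i = s i} =
      Set.pi (Finset.range k : Set ℕ) (fun i => ({s i} : Set Bool)) := by
    ext X
    simp [Set.mem_pi]
  rw [fairCoinMeasure, h, Measure.infinitePi_pi _ (fun i _ => MeasurableSet.singleton (s i))]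
  simp

/-- The partial recursive functionals `Ψ : 2^ℕ × ℕ ⇀ ℕ`, i.e. the partial functions
`(X, n) ↦ φ_e^X(n)` computed by an oracle program which may query the bits of the oracle `X`:
the smallest class of functionals that contains the basic functions and the oracle and is closed
under pairing, composition, primitive recursion and unbounded search, all uniformly in `X`.
The clauses are those of `Nat.Partrec`, together with the oracle. -/
inductive PartrecFunctional : ((ℕ → Bool) → ℕ →. ℕ) → Prop
  | zero : PartrecFunctional fun _ _ => Part.some 0
  | succ : PartrecFunctional fun _ n => Part.some (n + 1)
  | left : PartrecFunctional fun _ n => Part.some (Nat.unpair n).1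
  | right : PartrecFunctional fun _ n => Part.some (Nat.unpair n).2
  | oracle : PartrecFunctional fun X n => Part.some (X n).toNat
  | pair {Φ Ψ : (ℕ → Bool) → ℕ →. ℕ} (hΦ : PartrecFunctional Φ) (hΨ : PartrecFunctional Ψ) :
      PartrecFunctional fun X n => Nat.pair <$> Φ X n <*> Ψ X n
  | comp {Φ Ψ : (ℕ → Bool) → ℕ →. ℕ} (hΦ : PartrecFunctional Φ) (hΨ : PartrecFunctional Ψ) :
      PartrecFunctional fun X n => Ψ X n >>= Φ X
  | prec {Φ Ψ : (ℕ → Bool) → ℕ →. ℕ} (hΦ : PartrecFunctional Φ) (hΨ : PartrecFunctional Ψ) :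
      PartrecFunctional fun X => Nat.unpaired fun a n =>
        n.rec (Φ X a) fun y IH => do
          let i ← IH
          Ψ X (Nat.pair a (Nat.pair y i))
  | rfind {Φ : (ℕ → Bool) → ℕ →. ℕ} (hΦ : PartrecFunctional Φ) :
      PartrecFunctional fun X a =>
        Nat.rfind fun n => (fun m => decide (m = 0)) <$> Φ X (Nat.pair a n)

/-- `V 0, V 1, …` is a uniformly `Σ⁰₁` (effectively open) sequence of subsets of Cantor space:
`V n` consists of those `X` for which one fixed oracle program halts on input `n` with oracle `X`.
(By the parameterization theorem this says that `V n = {X | φ_{f(n)}^X(0) ↓}` for a total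
recursive `f`.) -/
def UniformlySigma01 (V : ℕ → Set (ℕ → Bool)) : Prop :=
  ∃ Ψ : (ℕ → Bool) → ℕ →. ℕ, PartrecFunctional Ψ ∧ ∀ n, V n = {X | (Ψ X n).Dom}

/-- Effectively null sets: those covered by a Martin-Löf test. -/
def EffectivelyNull (S : Set (ℕ → Bool)) : Prop :=
  ∃ V : ℕ → Set (ℕ → Bool), UniformlySigma01 V ∧
    (∀ n, fairCoinMeasure (V n) ≤ (2⁻¹ : ℝ≥0∞) ^ n) ∧ S ⊆ ⋂ n, V n

/-- Martin-Löf randomness. -/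
def IsMartinLofRandom (X : ℕ → Bool) : Prop :=
  ∀ S : Set (ℕ → Bool), EffectivelyNull S → X ∉ S

/-- `S_n = ∑_{i < n} X(i)`, the number of ones among the first `n` bits of `X`. -/
def onesCount (X : ℕ → Bool) (n : ℕ) : ℕ :=
  ∑ i ∈ Finset.range n, (X i).toNat

/-- The normalizing sequence `√((n/2) log log n)` (positive for `n ≥ 3`). -/
noncomputable def lilScale (n : ℕ) : ℝ :=
  Real.sqrt ((n : ℝ) / 2 * Real.log (Real.log n))

/-! Both halves of the classical Borel–Cantelli proof are made effective: each exceptional event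
becomes a Martin-Löf test with measures at most `2⁻ᵏ`, which a random `X` must escape at some level.
Upper half. Cut the range of `n` with `logLogTwo n = i` into `r * 2 ^ i` pieces of ratio `q = 2 ^ (1
/ r)`. The maximal Chernoff bound makes the walk `2 * S_n - n` cross `√(ρ * n * i)` on one piece
with probability at most `exp (-(ρ / (2 * q)) * i)`. If `ρ > 2 * log 2` and `r` is large, the sum
over the pieces is `r * θ ^ i` with `θ < 1`, so the tails of the series bound a test
(`eventually_walk_le`). Lower half. Look at the independent blocks between consecutive `2 * Q ^ j`.
A bound for binomial tails with the sharp exponent gives the `j`-th block a large excess of ones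
with probability at least `1 / (j + 1)`. The probability that no block `j` with `M ≤ j < M * 2 ^ k`
has one is at most `∏ j / (j + 1) = 2⁻ᵏ`, again a test, so large excesses recur. The bits before
such a block cannot cancel it: by the upper half for the flipped sequence their deficit is small
relative to the block once `Q` is large. Flipping bits preserves measure and computability, hence
randomness, which also yields the liminf and the absolute value. -/

/-! ### Computable functionals -/

/-- A total functional computed by an oracle program. -/
def ComputableFunctional (F : (ℕ → Bool) → ℕ → ℕ) : Prop :=
  PartrecFunctional fun X n => Part.some (F X n)

theorem PartrecFunctional.of_partrec {f : ℕ →. ℕ} (hf : Nat.Partrec f) :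
    PartrecFunctional fun _ => f := by
  induction hf with
  | zero => exact .zero
  | succ => exact .succ
  | left => exact .left
  | right => exact .right
  | pair _ _ hf hg => exact .pair hf hg
  | comp _ _ hf hg => exact .comp hf hg
  | prec _ _ hf hg => exact .prec hf hg
  | rfind _ hf => exact .rfind hf

namespace ComputableFunctional

theorem of_primrec {f : ℕ → ℕ} (hf : Primrec f) : ComputableFunctional fun _ => f :=
  PartrecFunctional.of_partrec (Nat.Partrec.of_primrec (Primrec.nat_iff.1 hf))

theorem comp {F G : (ℕ → Bool) → ℕ → ℕ} (hF : ComputableFunctional F)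
    (hG : ComputableFunctional G) : ComputableFunctional fun X n => F X (G X n) := by
  have := PartrecFunctional.comp hF hG
  simpa only [ComputableFunctional, Part.bind_eq_bind, Part.bind_some] using this

theorem pair {F G : (ℕ → Bool) → ℕ → ℕ} (hF : ComputableFunctional F)
    (hG : ComputableFunctional G) : ComputableFunctional fun X n => Nat.pair (F X n) (G X n) := by
  have := PartrecFunctional.pair hF hG
  simpa only [ComputableFunctional, Part.map_eq_map, Part.map_some, Seq.seq, Part.bind_some]
    using this

theorem comp_primrec {g : ℕ → ℕ} (hg : Primrec g) {F : (ℕ → Bool) → ℕ → ℕ}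
    (hF : ComputableFunctional F) : ComputableFunctional fun X n => g (F X n) :=
  (of_primrec hg).comp hF

theorem comp_primrec₂ {g : ℕ → ℕ → ℕ} (hg : Primrec₂ g) {F G : (ℕ → Bool) → ℕ → ℕ}
    (hF : ComputableFunctional F) (hG : ComputableFunctional G) :
    ComputableFunctional fun X n => g (F X n) (G X n) := by
  have h : Primrec fun m : ℕ => g m.unpair.1 m.unpair.2 :=
    hg.comp (Primrec.fst.comp Primrec.unpair) (Primrec.snd.comp Primrec.unpair)
  simpa using comp_primrec h (hF.pair hG)

/-- Primitive recursion with the running sum as accumulator and a dummy parameter `0`. -/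
theorem sum_range {F : (ℕ → Bool) → ℕ → ℕ} (hF : ComputableFunctional F) :
    ComputableFunctional fun X n => ∑ i ∈ Finset.range n, F X i := by
  have hstep : ComputableFunctional fun X m => m.unpair.2.unpair.2 + F X m.unpair.2.unpair.1 := by
    have h2 : Primrec fun m : ℕ => m.unpair.2 := Primrec.snd.comp Primrec.unpair
    have h1 : Primrec fun m : ℕ => m.unpair.1 := Primrec.fst.comp Primrec.unpair
    exact comp_primrec₂ Primrec.nat_add (of_primrec (h2.comp h2))
      (hF.comp (of_primrec (h1.comp h2)))
  have h := PartrecFunctional.prec (of_primrec (Primrec.const 0)) hstep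
  have h' := PartrecFunctional.comp h
    (of_primrec (f := fun n => Nat.pair 0 n) (Primrec₂.natPair.comp (Primrec.const 0) Primrec.id))
  refine cast (congrArg PartrecFunctional ?_) h'
  funext X n
  simp only [Part.bind_eq_bind, Part.bind_some, Nat.unpaired, Nat.unpair_pair]
  induction n with
  | zero => simp
  | succ n ih => simp only [ih, Part.bind_some, Finset.sum_range_succ]

theorem onesCount : ComputableFunctional onesCount :=
  sum_range PartrecFunctional.oracle

/-- As `F` is total, the unbounded search for a zero is never blocked and halts exactly when a zero
exists. Both tests are put into this form. -/
theorem uniformlySigma01 {F : (ℕ → Bool) → ℕ → ℕ} (hF : ComputableFunctional F) :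
    UniformlySigma01 fun k => {X | ∃ n, F X (Nat.pair k n) = 0} := by
  refine ⟨_, PartrecFunctional.rfind hF, fun k => ?_⟩
  ext X
  constructor
  · rintro ⟨n, hn⟩
    exact Nat.rfind_dom.2 ⟨n, by simp [hn], fun _ => trivial⟩
  · intro h
    obtain ⟨n, hn, -⟩ := Nat.rfind_dom.1 h
    exact ⟨n, by simpa [eq_comm] using hn⟩

end ComputableFunctional

/-- Only the oracle clause looks at `X`; there the answer `b` is replaced by `1 - b`. -/
theorem PartrecFunctional.comp_not {Φ : (ℕ → Bool) → ℕ →. ℕ} (hΦ : PartrecFunctional Φ) :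
    PartrecFunctional fun X => Φ fun i => !X i := by
  induction hΦ with
  | zero => exact .zero
  | succ => exact .succ
  | left => exact .left
  | right => exact .right
  | pair _ _ hf hg => exact .pair hf hg
  | comp _ _ hf hg => exact .comp hf hg
  | prec _ _ hf hg => exact .prec hf hg
  | rfind _ hf => exact .rfind hf
  | oracle =>
    have h : ComputableFunctional fun X n => 1 - (X n).toNat :=
      ComputableFunctional.comp_primrec (g := fun m => 1 - m)
        (Primrec.nat_sub.comp (Primrec.const 1) Primrec.id) PartrecFunctional.oracle
    refine cast (congrArg PartrecFunctional ?_) h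
    funext X n
    cases h : X n <;> simp [h]

theorem UniformlySigma01.preimage_not {V : ℕ → Set (ℕ → Bool)} (hV : UniformlySigma01 V) :
    UniformlySigma01 fun n => {X | (fun i => !X i) ∈ V n} := by
  obtain ⟨Ψ, hΨ, h⟩ := hV
  exact ⟨_, hΨ.comp_not, fun n => by ext X; simp [h]⟩

/-! ### Primitive recursive powers and binary logarithms -/

theorem Primrec.nat_pow : Primrec₂ ((· ^ ·) : ℕ → ℕ → ℕ) := by
  have h : Primrec₂ fun (a n : ℕ) => (Nat.rec 1 (fun _ i => i * a) n : ℕ) :=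
    Primrec.nat_rec (Primrec.const 1)
      (Primrec.nat_mul.comp (Primrec.snd.comp Primrec.snd) Primrec.fst).to₂
  refine h.of_eq fun a n => ?_
  induction n with
  | zero => simp
  | succ n ih => simp only [ih, pow_succ]

theorem Primrec.nat_log_two : Primrec (Nat.log 2) := by
  have h : Primrec fun n : ℕ => n.findGreatest fun y => 2 ^ y ≤ n :=
    Primrec.nat_findGreatest Primrec.id
      (Primrec.nat_le.comp (Primrec.nat_pow.comp (Primrec.const 2) Primrec.snd) Primrec.fst)
  refine h.of_eq fun n => ?_
  rcases Nat.eq_zero_or_pos n with rfl | hn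
  · simp
  refine (Nat.findGreatest_eq_iff).2 ⟨Nat.log_le_self 2 n, fun _ => Nat.pow_log_le_self 2 hn.ne',
    fun y hy _ => ?_⟩
  exact not_le.2 ((Nat.log_lt_iff_lt_pow one_lt_two hn.ne').1 hy)

/-! ### The fair coin measure -/

/-- The sequence `b, X 0, X 1, …`. -/
def prependBit (b : Bool) (X : ℕ → Bool) : ℕ → Bool
  | 0 => b
  | n + 1 => X n

theorem measurable_prependBit (b : Bool) : Measurable (prependBit b) := by
  refine measurable_pi_lambda _ fun n => ?_
  cases n with
  | zero => exact measurable_const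
  | succ n => exact measurable_pi_apply n

instance : IsProbabilityMeasure fairCoinMeasure := by
  unfold fairCoinMeasure; infer_instance

theorem uniformBool_toMeasure (A : Set Bool) :
    (PMF.uniformOfFintype Bool).toMeasure A =
      2⁻¹ * A.indicator 1 true + 2⁻¹ * A.indicator 1 false := by
  rw [PMF.toMeasure_apply_fintype]
  by_cases h1 : true ∈ A <;> by_cases h2 : false ∈ A <;> simp [h1, h2]

/-- Self-similarity: conditioning on the first bit leaves a fair coin sequence. The later inductions
on the number of bits rest on this. -/
theorem fairCoinMeasure_eq_prependBit :
    fairCoinMeasure = (2⁻¹ : ℝ≥0∞) • fairCoinMeasure.map (prependBit true) +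
      (2⁻¹ : ℝ≥0∞) • fairCoinMeasure.map (prependBit false) := by
  symm
  refine Measure.eq_infinitePi _ fun s t ht => ?_
  classical
  obtain ⟨N, hN⟩ : ∃ N, s ⊆ Finset.range (N + 1) :=
    ⟨s.sup id, fun i hi => Finset.mem_range_succ_iff.2 (Finset.le_sup (f := id) hi)⟩
  -- Pad the box with trivial factors to the initial segment `range (N + 1)`, so that coordinate `0`
  -- can be split off.
  set u : ℕ → Set Bool := fun i => if i ∈ s then t i else Set.univ with hu
  have hset : Set.pi (s : Set ℕ) t = Set.pi (Finset.range (N + 1) : Set ℕ) u := by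
    ext X
    simp only [Set.mem_pi, hu]
    refine ⟨fun h i _ => ?_, fun h i hi => ?_⟩
    · split_ifs with his
      · exact h i his
      · trivial
    · have := h i (hN hi)
      rwa [if_pos (by exact hi)] at this
  have hprod : ∏ i ∈ s, (PMF.uniformOfFintype Bool).toMeasure (t i) =
      ∏ i ∈ Finset.range (N + 1), (PMF.uniformOfFintype Bool).toMeasure (u i) := by
    rw [← Finset.prod_subset hN]
    · exact Finset.prod_congr rfl fun i hi => by simp [hu, hi]
    · intro i _ hi
      simp only [hu, if_neg hi]
      exact measure_univ
  have hum : MeasurableSet (Set.pi (Finset.range (N + 1) : Set ℕ) u) :=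
    MeasurableSet.pi (Finset.countable_toSet _) fun i _ => MeasurableSet.of_discrete
  have key (b : Bool) : fairCoinMeasure.map (prependBit b)
      (Set.pi (Finset.range (N + 1) : Set ℕ) u) = (u 0).indicator 1 b *
        ∏ i ∈ Finset.range N, (PMF.uniformOfFintype Bool).toMeasure (u (i + 1)) := by
    rw [Measure.map_apply (measurable_prependBit b) hum]
    by_cases hb : b ∈ u 0
    · have : prependBit b ⁻¹' (Set.pi (Finset.range (N + 1) : Set ℕ) u) =
          Set.pi (Finset.range N : Set ℕ) fun i => u (i + 1) := by
        ext X
        simp only [Set.mem_preimage, Set.mem_pi, Finset.coe_range, Set.mem_Iio]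
        refine ⟨fun h i hi => h (i + 1) (by omega), fun h i hi => ?_⟩
        cases i with
        | zero => exact hb
        | succ i => exact h i (by omega)
      rw [this, fairCoinMeasure, Measure.infinitePi_pi _ (fun _ _ => MeasurableSet.of_discrete)]
      simp [hb]
    · have : prependBit b ⁻¹' (Set.pi (Finset.range (N + 1) : Set ℕ) u) = ∅ := by
        ext X
        simp only [Set.mem_preimage, Set.mem_pi, Finset.coe_range, Set.mem_Iio,
          Set.mem_empty_iff_false, iff_false]
        exact fun h => hb (h 0 (by omega))
      rw [this]
      simp [hb]
  rw [hset, hprod, Finset.prod_range_succ', uniformBool_toMeasure (u 0)]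
  simp only [Measure.add_apply, Measure.smul_apply, key, smul_eq_mul]
  ring

theorem fairCoinMeasure_real_eq {A : Set (ℕ → Bool)} (hA : MeasurableSet A) :
    fairCoinMeasure.real A = (fairCoinMeasure.real (prependBit true ⁻¹' A) +
      fairCoinMeasure.real (prependBit false ⁻¹' A)) / 2 := by
  have h : fairCoinMeasure A = 2⁻¹ * fairCoinMeasure (prependBit true ⁻¹' A) +
      2⁻¹ * fairCoinMeasure (prependBit false ⁻¹' A) := by
    conv_lhs => rw [fairCoinMeasure_eq_prependBit]
    simp only [Measure.add_apply, Measure.smul_apply, smul_eq_mul,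
      Measure.map_apply (measurable_prependBit _) hA]
  rw [Measure.real, h, ENNReal.toReal_add (by finiteness) (by finiteness), ENNReal.toReal_mul,
    ENNReal.toReal_mul]
  simp only [ENNReal.toReal_inv, ENNReal.toReal_ofNat, Measure.real]
  ring

/-- Flipping every bit, as a measurable equivalence. -/
def flipEquiv : (ℕ → Bool) ≃ᵐ (ℕ → Bool) :=
  MeasurableEquiv.piCongrRight fun _ =>
    { toEquiv := Equiv.boolNot
      measurable_toFun := Measurable.of_discrete
      measurable_invFun := Measurable.of_discrete }

theorem measurePreserving_flipEquiv :
    MeasurePreserving flipEquiv fairCoinMeasure fairCoinMeasure := by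
  refine ⟨flipEquiv.measurable, ?_⟩
  refine Measure.eq_infinitePi _ fun s t ht => ?_
  have hm : MeasurableSet (Set.pi (s : Set ℕ) t) :=
    MeasurableSet.pi (Finset.countable_toSet _) fun i _ => MeasurableSet.of_discrete
  have : flipEquiv ⁻¹' (Set.pi (s : Set ℕ) t) = Set.pi (s : Set ℕ) fun i => not ⁻¹' t i := rfl
  rw [Measure.map_apply flipEquiv.measurable hm, this, fairCoinMeasure,
    Measure.infinitePi_pi _ (fun _ _ => MeasurableSet.of_discrete)]
  refine Finset.prod_congr rfl fun i _ => ?_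
  rw [uniformBool_toMeasure, uniformBool_toMeasure]
  by_cases h1 : true ∈ t i <;> by_cases h2 : false ∈ t i <;> simp [h1, h2]

theorem fairCoinMeasure_preimage_not (V : Set (ℕ → Bool)) :
    fairCoinMeasure {X | (fun i => !X i) ∈ V} = fairCoinMeasure V :=
  measurePreserving_flipEquiv.measure_preimage_equiv V

/-- A test covering the flipped sequence pulls back along the flip to a test covering `X`. -/
theorem IsMartinLofRandom.not {X : ℕ → Bool} (hX : IsMartinLofRandom X) :
    IsMartinLofRandom fun i => !X i := by
  rintro S ⟨V, hV, hμ, hS⟩ hXS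
  refine hX {Y | (fun i => !Y i) ∈ S} ⟨_, hV.preimage_not, fun n => ?_, fun Y hY => ?_⟩ hXS
  · rw [fairCoinMeasure_preimage_not]
    exact hμ n
  · exact Set.mem_iInter.2 fun n => Set.mem_iInter.1 (hS hY) n

/-- A Martin-Löf random sequence passes every Martin-Löf test. -/
theorem IsMartinLofRandom.exists_notMem {X : ℕ → Bool} (hX : IsMartinLofRandom X)
    {V : ℕ → Set (ℕ → Bool)} (hV : UniformlySigma01 V)
    (hμ : ∀ n, fairCoinMeasure (V n) ≤ (2⁻¹ : ℝ≥0∞) ^ n) : ∃ n, X ∉ V n := by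
  have := hX _ ⟨V, hV, hμ, subset_rfl⟩
  simpa using this

/-! ### The number of ones -/

theorem measurable_onesCount (n : ℕ) : Measurable fun X => onesCount X n := by
  unfold onesCount
  exact Finset.measurable_sum _ fun i _ =>
    (Measurable.of_discrete (f := Bool.toNat)).comp (measurable_pi_apply i)

@[simp] theorem onesCount_zero (X : ℕ → Bool) : onesCount X 0 = 0 := rfl

theorem onesCount_prependBit_succ (b : Bool) (X : ℕ → Bool) (n : ℕ) :
    onesCount (prependBit b X) (n + 1) = onesCount X n + b.toNat := by
  simp [onesCount, Finset.sum_range_succ', prependBit]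

theorem onesCount_add (X : ℕ → Bool) (m n : ℕ) :
    onesCount X (m + n) = onesCount X m + onesCount (fun i => X (m + i)) n := by
  simp [onesCount, Finset.sum_range_add]

theorem onesCount_not (X : ℕ → Bool) (n : ℕ) :
    (onesCount (fun i => !X i) n : ℝ) = n - onesCount X n := by
  rw [eq_sub_iff_add_eq]
  norm_cast
  rw [onesCount, onesCount, ← Finset.sum_add_distrib]
  trans ∑ i ∈ Finset.range n, 1
  · exact Finset.sum_congr rfl fun i _ => by cases X i <;> rfl
  · simp

/-- Conditioning on the first bit is Pascal's rule. -/
theorem fairCoinMeasure_onesCount_eq (N j : ℕ) :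
    fairCoinMeasure.real {X | onesCount X N = j} = (N.choose j : ℝ) / 2 ^ N := by
  induction N generalizing j with
  | zero => cases j <;> simp
  | succ N ih =>
    have hm : MeasurableSet {X | onesCount X (N + 1) = j} :=
      measurable_onesCount _ (measurableSet_singleton j)
    rw [fairCoinMeasure_real_eq hm]
    simp only [Set.preimage_ofPred_eq, onesCount_prependBit_succ, Bool.toNat_true,
      Bool.toNat_false, add_zero]
    cases j with
    | zero => simp [ih, pow_succ]; ring
    | succ j =>
      simp only [Nat.add_right_cancel_iff, ih, Nat.choose_succ_succ]
      push_cast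
      rw [pow_succ]
      field_simp

/-- Doob's maximal inequality for the exponential martingale, by induction. The first step moves the
barrier `a` by `∓1`, and the resulting factors `exp s`, `exp (-s)` average to `cosh s`; for `a ≤ 0`
the right side is at least `1`. -/
theorem fairCoinMeasure_exists_walk_ge_le_cosh (N : ℕ) (a s : ℝ) (hs : 0 ≤ s) :
    fairCoinMeasure.real {X | ∃ n ≤ N, a ≤ 2 * (onesCount X n : ℝ) - n} ≤
      Real.exp (-(s * a)) * Real.cosh s ^ N := by
  induction N generalizing a with
  | zero =>
    by_cases ha : a ≤ 0
    · simpa [ha] using mul_nonneg hs (neg_nonneg.2 ha)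
    · simp [ha, Real.exp_nonneg]
  | succ N ih =>
    by_cases ha : a ≤ 0
    · refine measureReal_le_one.trans (one_le_mul_of_one_le_of_one_le ?_ ?_)
      · exact Real.one_le_exp (by nlinarith)
      · exact one_le_pow₀ (Real.one_le_cosh s)
    have hm : MeasurableSet {X | ∃ n ≤ N + 1, a ≤ 2 * (onesCount X n : ℝ) - n} := by
      have : {X | ∃ n ≤ N + 1, a ≤ 2 * (onesCount X n : ℝ) - n} =
          ⋃ n ∈ Set.Iic (N + 1), {X | a ≤ 2 * (onesCount X n : ℝ) - n} := by
        ext X; simp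
      rw [this]
      exact MeasurableSet.biUnion (Set.to_countable _) fun n _ =>
        measurable_onesCount n (MeasurableSet.of_discrete (s := {m : ℕ | a ≤ 2 * (m : ℝ) - n}))
    have key (b : Bool) : prependBit b ⁻¹' {X | ∃ n ≤ N + 1, a ≤ 2 * (onesCount X n : ℝ) - n} =
        {X | ∃ n ≤ N, a - (2 * b.toNat - 1) ≤ 2 * (onesCount X n : ℝ) - n} := by
      ext X
      simp only [Set.mem_preimage, Set.mem_ofPred_eq]
      constructor
      · rintro ⟨n, hn, h⟩
        cases n with
        | zero => simp at h; exact absurd h ha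
        | succ n =>
          rw [onesCount_prependBit_succ] at h
          push_cast at h
          exact ⟨n, by omega, by linarith⟩
      · rintro ⟨n, hn, h⟩
        refine ⟨n + 1, by omega, ?_⟩
        rw [onesCount_prependBit_succ]
        push_cast
        linarith
    rw [fairCoinMeasure_real_eq hm, key, key]
    have h1 := ih (a - (2 * (true.toNat : ℝ) - 1))
    have h2 := ih (a - (2 * (false.toNat : ℝ) - 1))
    have e1 : Real.exp (-(s * (a - (2 * (true.toNat : ℝ) - 1)))) =
        Real.exp (-(s * a)) * Real.exp s := by
      rw [← Real.exp_add]; congr 1; simp; ring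
    have e2 : Real.exp (-(s * (a - (2 * (false.toNat : ℝ) - 1)))) =
        Real.exp (-(s * a)) * Real.exp (-s) := by
      rw [← Real.exp_add]; congr 1; simp; ring
    rw [e1] at h1
    rw [e2] at h2
    rw [pow_succ, Real.cosh_eq s] at *
    linarith

/-- The maximal form of the Chernoff bound for the simple random walk. -/
theorem fairCoinMeasure_exists_walk_ge_le (y a : ℝ) (hy : 0 < y) (ha : 0 ≤ a) :
    fairCoinMeasure.real {X | ∃ n : ℕ, (n : ℝ) ≤ y ∧ a ≤ 2 * (onesCount X n : ℝ) - n} ≤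
      Real.exp (-(a ^ 2 / (2 * y))) := by
  have hset : {X | ∃ n : ℕ, (n : ℝ) ≤ y ∧ a ≤ 2 * (onesCount X n : ℝ) - n} =
      {X | ∃ n ≤ ⌊y⌋₊, a ≤ 2 * (onesCount X n : ℝ) - n} := by
    ext X; simp [Nat.le_floor_iff hy.le]
  rw [hset]
  -- With `cosh s ≤ exp (s ^ 2 / 2)` the exponent is at most `-s * a + y * s ^ 2 / 2`, which is
  -- minimal at `s = a / y`.
  have hs : 0 ≤ a / y := by positivity
  refine (fairCoinMeasure_exists_walk_ge_le_cosh ⌊y⌋₊ a (a / y) hs).trans ?_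
  have h1 : Real.cosh (a / y) ^ ⌊y⌋₊ ≤ Real.exp (a ^ 2 / (2 * y)) := by
    calc Real.cosh (a / y) ^ ⌊y⌋₊ ≤ Real.exp ((a / y) ^ 2 / 2) ^ ⌊y⌋₊ :=
          pow_le_pow_left₀ (Real.cosh_pos _).le (Real.cosh_le_exp_half_sq _) _
      _ = Real.exp (⌊y⌋₊ * ((a / y) ^ 2 / 2)) := by rw [← Real.exp_nat_mul]
      _ ≤ Real.exp (y * ((a / y) ^ 2 / 2)) := by
          gcongr
          exact Nat.floor_le hy.le
      _ = _ := by congr 1; field_simp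
  calc _ ≤ Real.exp (-(a / y * a)) * Real.exp (a ^ 2 / (2 * y)) := by gcongr
    _ = _ := by rw [← Real.exp_add]; congr 1; field_simp; ring

theorem measurable_shift (n : ℕ) : Measurable fun (X : ℕ → Bool) i => X (n + i) :=
  measurable_pi_lambda _ fun i => measurable_pi_apply (n + i)

/-- The first `n` bits are independent of the others. -/
theorem fairCoinMeasure_inter_shift (n : ℕ) {A B : Set (ℕ → Bool)} (hA : MeasurableSet A)
    (hB : MeasurableSet B) (h : ∀ X Y : ℕ → Bool, (∀ i < n, X i = Y i) → X ∈ A → Y ∈ A) :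
    fairCoinMeasure.real (A ∩ {X | (fun i => X (n + i)) ∈ B}) =
      fairCoinMeasure.real A * fairCoinMeasure.real B := by
  induction n generalizing A with
  | zero =>
    -- An event depending on no bits is empty or everything.
    rcases A.eq_empty_or_nonempty with rfl | ⟨X, hX⟩
    · simp
    · have : A = Set.univ := Set.eq_univ_of_forall fun Y => h X Y (by simp) hX
      simp only [this, Set.univ_inter, zero_add, probReal_univ, one_mul]
      rfl
  | succ n ih =>
    have hm : MeasurableSet {X : ℕ → Bool | (fun i => X (n + 1 + i)) ∈ B} := measurable_shift _ hB
    rw [fairCoinMeasure_real_eq (hA.inter hm), fairCoinMeasure_real_eq hA]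
    have key (b : Bool) : fairCoinMeasure.real
        (prependBit b ⁻¹' (A ∩ {X | (fun i => X (n + 1 + i)) ∈ B})) =
        fairCoinMeasure.real (prependBit b ⁻¹' A) * fairCoinMeasure.real B := by
      rw [← ih (measurable_prependBit b hA)]
      · congr 1
        ext X
        simp only [Set.mem_preimage, Set.mem_inter_iff, Set.mem_ofPred_eq]
        have : (fun i => prependBit b X (n + 1 + i)) = fun i => X (n + i) := by
          funext i
          rw [Nat.add_right_comm]
          rfl
        rw [this]
      · intro X Y hXY
        refine h _ _ fun i hi => ?_
        cases i with
        | zero => rfl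
        | succ i => exact hXY i (by omega)
    rw [key, key]
    ring

/-! ### The upper half of the law of the iterated logarithm -/

/-- An integer approximation of `log log n / log 2`. -/
def logLogTwo (n : ℕ) : ℕ := Nat.log 2 (Nat.log 2 n)

theorem primrec_logLogTwo : Primrec logLogTwo := Primrec.nat_log_two.comp Primrec.nat_log_two

theorem pow_pow_le_of_logLogTwo_eq {n i : ℕ} (hi : 1 ≤ i) (h : logLogTwo n = i) :
    2 ^ 2 ^ i ≤ n ∧ n < 2 ^ 2 ^ (i + 1) := by
  subst h
  have h1 : Nat.log 2 n ≠ 0 := by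
    intro h0
    simp [logLogTwo, h0] at hi
  have h2 : n ≠ 0 := by
    rintro rfl
    simp at h1
  have h3 : 2 ^ logLogTwo n ≤ Nat.log 2 n := Nat.pow_log_le_self 2 h1
  have h4 : Nat.log 2 n < 2 ^ (logLogTwo n + 1) := Nat.lt_pow_succ_log_self one_lt_two _
  exact ⟨(Nat.pow_le_pow_right two_pos h3).trans (Nat.pow_log_le_self 2 h2),
    (Nat.lt_pow_succ_log_self one_lt_two n).trans_le (Nat.pow_le_pow_right two_pos h4)⟩

theorem tendsto_logLogTwo : Tendsto logLogTwo atTop atTop := by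
  have h : Tendsto (Nat.log 2) atTop atTop :=
    tendsto_atTop.2 fun b => by
      filter_upwards [eventually_ge_atTop (2 ^ b)] with n hn
      exact Nat.le_log_of_pow_le one_lt_two hn
  exact h.comp h

theorem logLogTwo_mul_log_two_le {n : ℕ} (hn : 1 ≤ logLogTwo n) :
    logLogTwo n * Real.log 2 ≤ Real.log (Real.log n) - Real.log (Real.log 2) := by
  have h := (pow_pow_le_of_logLogTwo_eq hn rfl).1
  have h2 : (0 : ℝ) < Real.log 2 := Real.log_pos one_lt_two
  have h3 : (2 : ℝ) ^ logLogTwo n * Real.log 2 ≤ Real.log n := by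
    have : ((2 : ℝ) ^ (2 ^ logLogTwo n)) ≤ n := by exact_mod_cast h
    have := Real.log_le_log (by positivity) this
    rw [Real.log_pow] at this
    exact_mod_cast this
  have h4 := Real.log_le_log (by positivity) h3
  rw [Real.log_mul (by positivity) h2.ne', Real.log_pow] at h4
  linarith

theorem tendsto_log_log_natCast :
    Tendsto (fun n : ℕ => Real.log (Real.log n)) atTop atTop :=
  Real.tendsto_log_atTop.comp (Real.tendsto_log_atTop.comp tendsto_natCast_atTop_atTop)

/-- Union bound over geometric pieces `[x, q * x)`: on each, the barrier is lowered to its value at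
`x` and the horizon raised to `q * x`, which costs a factor `q` in the exponent. -/
theorem fairCoinMeasure_exists_logLogTwo_eq_le {i r : ℕ} (hi : 1 ≤ i) (hr : 1 ≤ r) {ρ : ℝ}
    (hρ : 0 ≤ ρ) :
    fairCoinMeasure.real {X | ∃ n : ℕ, logLogTwo n = i ∧
        √(ρ * n * i) ≤ 2 * (onesCount X n : ℝ) - n} ≤
      r * 2 ^ i * Real.exp (-(ρ / (2 * 2 ^ (1 / (r : ℝ))) * i)) := by
  have hr0 : (0 : ℝ) < r := by exact_mod_cast hr
  set q : ℝ := 2 ^ (1 / (r : ℝ)) with hq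
  have hq1 : 1 < q := Real.one_lt_rpow one_lt_two (by positivity)
  have hqr : q ^ r = 2 := by
    rw [hq, ← Real.rpow_natCast, ← Real.rpow_mul (by norm_num)]
    simp [hr0.ne']
  -- The endpoints of the range have ratio `2 ^ 2 ^ i = q ^ (r * 2 ^ i)`, so `r * 2 ^ i` pieces
  -- suffice.
  set x : ℕ → ℝ := fun m => 2 ^ 2 ^ i * q ^ m with hx
  have hxpos (m : ℕ) : 0 < x m := by positivity
  have hsub : {X | ∃ n : ℕ, logLogTwo n = i ∧ √(ρ * n * i) ≤ 2 * (onesCount X n : ℝ) - n} ⊆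
      ⋃ m ∈ Finset.range (r * 2 ^ i), {X | ∃ n : ℕ, (n : ℝ) ≤ q * x m ∧
        √(ρ * x m * i) ≤ 2 * (onesCount X n : ℝ) - n} := by
    rintro X ⟨n, hn, h⟩
    obtain ⟨h1, h2⟩ := pow_pow_le_of_logLogTwo_eq hi hn
    have h1' : (2 : ℝ) ^ 2 ^ i ≤ n := by exact_mod_cast h1
    have h2' : (n : ℝ) < 2 ^ 2 ^ i * 2 ^ 2 ^ i := by
      rw [← pow_add, ← two_mul, ← pow_succ']
      exact_mod_cast h2
    have hp : (0 : ℝ) < 2 ^ 2 ^ i := by positivity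
    obtain ⟨m, hm1, hm2⟩ := exists_nat_pow_near ((one_le_div hp).2 h1') hq1
    have hm3 : m < r * 2 ^ i := by
      rw [← pow_lt_pow_iff_right₀ hq1, pow_mul, hqr]
      exact hm1.trans_lt ((div_lt_iff₀ hp).2 h2')
    rw [le_div_iff₀' hp] at hm1
    rw [div_lt_iff₀' hp] at hm2
    refine Set.mem_biUnion (Finset.mem_coe.2 (Finset.mem_range.2 hm3)) ⟨n, ?_, le_trans ?_ h⟩
    · refine hm2.le.trans (le_of_eq ?_)
      rw [hx, pow_succ]; ring
    · gcongr
  refine (measureReal_mono hsub (measure_ne_top _ _)).trans ((measureReal_biUnion_finset_le _ _).trans ?_)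
  have hb (m : ℕ) : fairCoinMeasure.real {X | ∃ n : ℕ, (n : ℝ) ≤ q * x m ∧
        √(ρ * x m * i) ≤ 2 * (onesCount X n : ℝ) - n} ≤ Real.exp (-(ρ / (2 * q) * i)) := by
    refine (fairCoinMeasure_exists_walk_ge_le _ _ (by have := hxpos m; positivity)
      (Real.sqrt_nonneg _)).trans (le_of_eq ?_)
    have := hxpos m
    rw [Real.sq_sqrt (by positivity)]
    congr 2
    field_simp
  refine (Finset.sum_le_sum fun m _ => hb m).trans (le_of_eq ?_)
  simp

/-- The test for the upper half of the law of the iterated logarithm. -/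
theorem uniformlySigma01_exists_walk_gt (a b c K : ℕ) :
    UniformlySigma01 fun k => {X | ∃ n, K * (k + c) ≤ logLogTwo n ∧ n < 2 * onesCount X n ∧
      a * n * logLogTwo n < b * (2 * onesCount X n - n) ^ 2} := by
  -- The inequality is squared to stay within ℕ; `n < 2 * s` keeps the truncated subtraction exact.
  -- The value `0` signals success to the search.
  let g : ℕ → ℕ → ℕ := fun m s => if K * (m.unpair.1 + c) ≤ logLogTwo m.unpair.2 ∧
    m.unpair.2 < 2 * s ∧ a * m.unpair.2 * logLogTwo m.unpair.2 < b * (2 * s - m.unpair.2) ^ 2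
    then 0 else 1
  have hk : Primrec fun p : ℕ × ℕ => p.1.unpair.1 :=
    (Primrec.fst.comp Primrec.unpair).comp Primrec.fst
  have hn : Primrec fun p : ℕ × ℕ => p.1.unpair.2 :=
    (Primrec.snd.comp Primrec.unpair).comp Primrec.fst
  have hL := primrec_logLogTwo.comp hn
  have hs : Primrec fun p : ℕ × ℕ => 2 * p.2 := Primrec.nat_mul.comp (Primrec.const 2) Primrec.snd
  have hg : Primrec₂ g := by
    refine Primrec.ite (PrimrecPred.and ?_ (PrimrecPred.and ?_ ?_)) (Primrec.const 0)
      (Primrec.const 1)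
    · exact Primrec.nat_le.comp (Primrec.nat_mul.comp (Primrec.const K)
        (Primrec.nat_add.comp hk (Primrec.const c))) hL
    · exact Primrec.nat_lt.comp hn hs
    · exact Primrec.nat_lt.comp
        (Primrec.nat_mul.comp (Primrec.nat_mul.comp (Primrec.const a) hn) hL)
        (Primrec.nat_mul.comp (Primrec.const b)
          (Primrec.nat_pow.comp (Primrec.nat_sub.comp hs hn) (Primrec.const 2)))
  have hF := (ComputableFunctional.comp_primrec₂ hg (ComputableFunctional.of_primrec Primrec.id)
    (ComputableFunctional.onesCount.comp (ComputableFunctional.of_primrec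
      (Primrec.snd.comp Primrec.unpair)))).uniformlySigma01
  simpa [g] using hF

theorem exists_log_two_lt_div_rpow {ρ : ℝ} (hρ : 2 * Real.log 2 < ρ) :
    ∃ r : ℕ, 1 ≤ r ∧ Real.log 2 < ρ / (2 * 2 ^ (1 / (r : ℝ))) := by
  have h1 : Tendsto (fun r : ℕ => ρ / (2 * (2 : ℝ) ^ (1 / (r : ℝ)))) atTop (nhds (ρ / (2 * 1))) := by
    have h2 : Tendsto (fun r : ℕ => (2 : ℝ) ^ (1 / (r : ℝ))) atTop (nhds 1) := by
      have := tendsto_const_nhds (x := (2 : ℝ)).rpow tendsto_one_div_atTop_nhds_zero_nat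
        (Or.inl two_ne_zero)
      simpa using this
    exact tendsto_const_nhds.div (tendsto_const_nhds.mul h2) (by norm_num)
  have h3 := h1.eventually (lt_mem_nhds (show Real.log 2 < ρ / (2 * 1) by linarith))
  obtain ⟨r, hr, hr1⟩ := (h3.and (eventually_ge_atTop 1)).exists
  exact ⟨r, hr1, hr⟩

theorem ratCast_eq_toNat_div_den {ρ : ℚ} (hρ : 0 < ρ) :
    (ρ : ℝ) = (ρ.num.toNat : ℝ) / (ρ.den : ℝ) := by
  have h1 : ((ρ.num.toNat : ℤ) : ℝ) = (ρ.num : ℝ) := by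
    rw [Int.toNat_of_nonneg (Rat.num_nonneg.2 hρ.le)]
  rw [← Int.cast_natCast, h1, ← Rat.cast_def]

/-- Effective first Borel–Cantelli lemma. Rationality of `ρ` makes the crossing condition decidable
in integers. -/
theorem IsMartinLofRandom.eventually_walk_le {X : ℕ → Bool} (hX : IsMartinLofRandom X) {ρ : ℚ}
    (hρ : 2 * Real.log 2 < ρ) :
    ∀ᶠ n : ℕ in atTop, 2 * (onesCount X n : ℝ) - n ≤ √(ρ * n * logLogTwo n) := by
  obtain ⟨r, hr1, hr⟩ := exists_log_two_lt_div_rpow hρ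
  have hl2 : (0 : ℝ) < Real.log 2 := Real.log_pos one_lt_two
  have hρ0 : (0 : ℝ) < ρ := by linarith
  have hρ0' : 0 < ρ := by exact_mod_cast hρ0
  set δ : ℝ := ρ / (2 * 2 ^ (1 / (r : ℝ))) - Real.log 2 with hδ
  have hδ0 : 0 < δ := by linarith
  set θ : ℝ := Real.exp (-δ) with hθ
  have hθ0 : 0 < θ := Real.exp_pos _
  have hθ1 : θ < 1 := by rw [hθ, Real.exp_lt_one_iff]; linarith
  -- Starting level `k` of the test at `i = K * (k + (c + 1))` gains `2⁻¹` per level; `c` absorbs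
  -- the constant `r / (1 - θ)` of the geometric tail.
  obtain ⟨K, hK⟩ := exists_pow_lt_of_lt_one (show (0 : ℝ) < 1 / 2 by norm_num) hθ1
  have hK1 : 1 ≤ K := by
    rcases Nat.eq_zero_or_pos K with rfl | h
    · norm_num at hK
    · exact h
  obtain ⟨c, hc⟩ := exists_pow_lt_of_lt_one
    (show (0 : ℝ) < (1 - θ) / (r + 1) by have := sub_pos.2 hθ1; positivity)
    (show (1 / 2 : ℝ) < 1 by norm_num)
  have hc' : r * (1 / 2 : ℝ) ^ (c + 1) ≤ 1 - θ := by
    rw [lt_div_iff₀ (by positivity)] at hc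
    have : (0 : ℝ) < (1 / 2) ^ c := by positivity
    rw [pow_succ]
    nlinarith
  set D : ℕ → Set (ℕ → Bool) := fun i => {X | ∃ n : ℕ, logLogTwo n = i ∧
        √(ρ * n * i) ≤ 2 * (onesCount X n : ℝ) - n} with hD
  have hDμ (i : ℕ) (hi : 1 ≤ i) : fairCoinMeasure (D i) ≤ ENNReal.ofReal (r * θ ^ i) := by
    rw [← ofReal_measureReal]
    refine ENNReal.ofReal_le_ofReal
      ((fairCoinMeasure_exists_logLogTwo_eq_le hi hr1 hρ0.le).trans (le_of_eq ?_))
    rw [hθ, ← Real.exp_nat_mul, mul_assoc]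
    congr 1
    have : (2 : ℝ) ^ i = Real.exp (i * Real.log 2) := by
      rw [Real.exp_nat_mul, Real.exp_log two_pos]
    rw [this, ← Real.exp_add, hδ]
    congr 1
    ring
  have hreal (a b n S L : ℕ) (hb : 0 < b) (h : n < 2 * S) :
      a * n * L < b * (2 * S - n) ^ 2 ↔ √((a / b : ℝ) * n * L) < 2 * (S : ℝ) - n := by
    have h' : (n : ℝ) < 2 * S := by exact_mod_cast h
    have hb' : (0 : ℝ) < b := by exact_mod_cast hb
    rw [Real.sqrt_lt' (by linarith), ← @Nat.cast_lt ℝ]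
    push_cast [Nat.cast_sub h.le]
    rw [show (a / b : ℝ) * n * L = (a * n * L) / b by ring, div_lt_iff₀' hb']
  have hρab := ratCast_eq_toNat_div_den hρ0'
  obtain ⟨k, hk⟩ := hX.exists_notMem
    (uniformlySigma01_exists_walk_gt ρ.num.toNat ρ.den (c + 1) K) fun k => by
    have hsub : {X | ∃ n, K * (k + (c + 1)) ≤ logLogTwo n ∧ n < 2 * onesCount X n ∧
        ρ.num.toNat * n * logLogTwo n < ρ.den * (2 * onesCount X n - n) ^ 2} ⊆
        ⋃ i, D (i + K * (k + (c + 1))) := by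
      rintro X ⟨n, h1, h2, h3⟩
      refine Set.mem_iUnion.2 ⟨logLogTwo n - K * (k + (c + 1)), n, by omega, ?_⟩
      rw [Nat.sub_add_cancel h1, hρab]
      exact ((hreal _ _ _ _ _ ρ.den_pos h2).1 h3).le
    set I := K * (k + (c + 1)) with hI
    have hI1 : 1 ≤ I := Nat.mul_pos hK1 (by omega)
    calc _ ≤ fairCoinMeasure (⋃ i, D (i + I)) := measure_mono hsub
      _ ≤ ∑' i, fairCoinMeasure (D (i + I)) := measure_iUnion_le _
      _ ≤ ∑' i, ENNReal.ofReal (r * θ ^ I * θ ^ i) := by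
          refine ENNReal.tsum_le_tsum fun i => (hDμ _ (by omega)).trans (le_of_eq ?_)
          rw [pow_add]
          congr 1
          ring
      _ = ENNReal.ofReal (r * θ ^ I * (1 - θ)⁻¹) := by
          rw [← ENNReal.ofReal_tsum_of_nonneg (fun i => by positivity)
            ((summable_geometric_of_lt_one hθ0.le hθ1).mul_left _), tsum_mul_left,
            tsum_geometric_of_lt_one hθ0.le hθ1]
      _ ≤ ENNReal.ofReal ((2⁻¹) ^ k) := by
          refine ENNReal.ofReal_le_ofReal ?_
          rw [← div_eq_mul_inv, div_le_iff₀ (sub_pos.2 hθ1)]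
          have h1 : θ ^ I ≤ (1 / 2) ^ k * (1 / 2) ^ (c + 1) := by
            rw [hI, pow_mul, ← pow_add]
            exact pow_le_pow_left₀ (by positivity) hK.le _
          calc r * θ ^ I ≤ r * ((1 / 2) ^ k * (1 / 2) ^ (c + 1)) := by gcongr
            _ = (2⁻¹) ^ k * (r * (1 / 2) ^ (c + 1)) := by rw [one_div]; ring
            _ ≤ (2⁻¹) ^ k * (1 - θ) := by gcongr
      _ = 2⁻¹ ^ k := by
          rw [ENNReal.ofReal_pow (by norm_num), ENNReal.ofReal_inv_of_pos two_pos]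
          simp
  filter_upwards [tendsto_logLogTwo.eventually_ge_atTop (K * (k + (c + 1)))] with n hn
  by_contra! hcon
  have h2 : n < 2 * onesCount X n := by
    have : (0 : ℝ) < 2 * onesCount X n - n := (Real.sqrt_nonneg _).trans_lt hcon
    rw [sub_pos] at this
    exact_mod_cast this
  refine hk ⟨n, hn, h2, ?_⟩
  rw [hreal _ _ _ _ _ ρ.den_pos h2, ← hρab]
  exact hcon

/-- `logLogTwo n` is at most `log log n / log 2` plus a constant. Taking `ρ` strictly below `2 * log
2 * l ^ 2` leaves the slack `η` that absorbs this constant. -/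
theorem IsMartinLofRandom.eventually_onesCount_le {X : ℕ → Bool} (hX : IsMartinLofRandom X)
    {l : ℝ} (hl : 1 < l) :
    ∀ᶠ n : ℕ in atTop, (onesCount X n : ℝ) ≤ n / 2 + l * lilScale n := by
  have hl2 : (0 : ℝ) < Real.log 2 := Real.log_pos one_lt_two
  obtain ⟨ρ, hρ1, hρ2⟩ := exists_rat_btwn
    (show 2 * Real.log 2 < 2 * Real.log 2 * l ^ 2 by nlinarith [mul_pos hl2 (sub_pos.2 hl)])
  have hρ0 : (0 : ℝ) < ρ := by linarith
  set η : ℝ := 2 * l ^ 2 - ρ / Real.log 2 with hη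
  have hη0 : 0 < η := by
    rw [hη, sub_pos, div_lt_iff₀ hl2]; linarith
  filter_upwards [hX.eventually_walk_le hρ1, tendsto_logLogTwo.eventually_ge_atTop 1,
    tendsto_log_log_natCast.eventually_ge_atTop
      (ρ / Real.log 2 * -Real.log (Real.log 2) / η)] with n h1 h2 h3
  have h4 := logLogTwo_mul_log_two_le h2
  rw [div_le_iff₀ hη0] at h3
  have h5 : ρ * logLogTwo n ≤ 2 * l ^ 2 * Real.log (Real.log n) := by
    have : ρ * logLogTwo n = ρ / Real.log 2 * (logLogTwo n * Real.log 2) := by field_simp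
    rw [this]
    have := mul_le_mul_of_nonneg_left h4 (show 0 ≤ ρ / Real.log 2 by positivity)
    rw [hη] at h3
    linarith
  have h6 : √(ρ * n * logLogTwo n) ≤ 2 * (l * lilScale n) := by
    have e : 2 * (l * lilScale n) = √(n * (2 * l ^ 2 * Real.log (Real.log n))) := by
      rw [lilScale, show (n : ℝ) * (2 * l ^ 2 * Real.log (Real.log n)) =
        (2 * l) ^ 2 * (n / 2 * Real.log (Real.log n)) by ring,
        Real.sqrt_mul (sq_nonneg (2 * l)), Real.sqrt_sq (by linarith)]
      ring
    rw [e, show (ρ : ℝ) * n * logLogTwo n = n * (ρ * logLogTwo n) by ring]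
    gcongr
  linarith

/-! ### A lower bound for the tails of the binomial distribution -/

theorem pow_mul_factorial_mul_factorial_le {m h : ℕ} (hm : m ≤ h) (j : ℕ) :
    m ^ j * ((h + j).factorial * m.factorial) ≤ h ^ j * (h.factorial * (m + j).factorial) := by
  induction j with
  | zero => simp
  | succ j ih =>
    have h1 : m * (h + j + 1) ≤ h * (m + j + 1) := by nlinarith
    rw [← add_assoc, ← add_assoc, Nat.factorial_succ, Nat.factorial_succ, pow_succ, pow_succ]
    calc m ^ j * m * ((h + j + 1) * (h + j).factorial * m.factorial)
        = (m * (h + j + 1)) * (m ^ j * ((h + j).factorial * m.factorial)) := by ring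
      _ ≤ (h * (m + j + 1)) * (h ^ j * (h.factorial * (m + j).factorial)) := Nat.mul_le_mul h1 ih
      _ = _ := by ring

/-- With `m = h - K`, the ratio to the central coefficient is the product of `(m + t) / (h + t)` for
`1 ≤ t ≤ K`, and each factor is at least `m / h`. -/
theorem centralBinom_mul_le_choose {h K : ℕ} (hh : 0 < h) (hK : K ≤ h) :
    (h.centralBinom : ℝ) * (1 - K / h) ^ K ≤ (2 * h).choose (h + K) := by
  obtain ⟨m, rfl⟩ := Nat.exists_eq_add_of_le' hK
  have h1 := pow_mul_factorial_mul_factorial_le (show m ≤ m + K by omega) K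
  have h2 : (2 * (m + K)).choose (m + K) * (m + K).factorial * (m + K).factorial =
      (2 * (m + K)).factorial := by
    have := Nat.choose_mul_factorial_mul_factorial (show m + K ≤ 2 * (m + K) by omega)
    rwa [show 2 * (m + K) - (m + K) = m + K by omega] at this
  have h3 : (2 * (m + K)).choose (m + K + K) * (m + K + K).factorial * m.factorial =
      (2 * (m + K)).factorial := by
    have := Nat.choose_mul_factorial_mul_factorial (show m + K + K ≤ 2 * (m + K) by omega)
    rwa [show 2 * (m + K) - (m + K + K) = m by omega] at this
  have h4 : (m + K).centralBinom * m ^ K ≤ (2 * (m + K)).choose (m + K + K) * (m + K) ^ K := by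
    refine Nat.le_of_mul_le_mul_right (c := (m + K).factorial * (m + K).factorial) ?_ (by positivity)
    rw [Nat.centralBinom]
    calc _ = (2 * (m + K)).choose (m + K + K) * (m ^ K * ((m + K + K).factorial * m.factorial)) := by
          rw [mul_right_comm, ← mul_assoc, h2, ← h3]; ring
      _ ≤ _ := by rw [mul_assoc]; exact Nat.mul_le_mul_left _ h1
  have h5 : (0 : ℝ) < ((m + K : ℕ) : ℝ) := by exact_mod_cast hh
  have h6 : (1 - (K : ℝ) / ((m + K : ℕ) : ℝ)) = m / ((m + K : ℕ) : ℝ) := by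
    field_simp; push_cast; ring
  rw [h6, div_pow, ← mul_div_assoc, div_le_iff₀ (by positivity)]
  exact_mod_cast h4

/-- An elementary substitute for Stirling, squared to stay in ℕ; the induction step is `4 * n * (n +
1) ≤ (2 * n + 1) ^ 2`. -/
theorem sixteen_pow_le_mul_centralBinom_sq {h : ℕ} (hh : 1 ≤ h) :
    16 ^ h ≤ 4 * h * h.centralBinom ^ 2 := by
  induction h, hh using Nat.le_induction with
  | base => decide
  | succ n hn ih =>
    have h1 := Nat.succ_mul_centralBinom_succ n
    refine Nat.le_of_mul_le_mul_right (c := n * (n + 1)) ?_ (by positivity)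
    calc 16 ^ (n + 1) * (n * (n + 1)) = 16 ^ n * (16 * (n * (n + 1))) := by ring
      _ ≤ (4 * n * n.centralBinom ^ 2) * (4 * (2 * n + 1) ^ 2) :=
          Nat.mul_le_mul ih (by nlinarith)
      _ = 4 * n * (2 * (2 * n + 1) * n.centralBinom) ^ 2 := by ring
      _ = 4 * n * ((n + 1) * (n + 1).centralBinom) ^ 2 := by rw [← h1]
      _ = _ := by ring

theorem one_le_two_mul_sqrt_mul_centralBinom_div {h : ℕ} (hh : 1 ≤ h) :
    1 ≤ 2 * √(h : ℝ) * (h.centralBinom / 2 ^ (2 * h)) := by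
  have h1 : ((16 : ℝ)) ^ h ≤ 4 * h * h.centralBinom ^ 2 := by
    exact_mod_cast sixteen_pow_le_mul_centralBinom_sq hh
  rw [← mul_div_assoc, one_le_div (by positivity)]
  refine (pow_le_pow_iff_left₀ (by positivity) (by positivity) two_ne_zero).1 ?_
  rw [mul_pow, mul_pow, Real.sq_sqrt (by positivity), pow_mul, ← pow_mul, mul_comm h 2, pow_mul]
  norm_num
  exact h1

/-- Summing `s ≥ √h` consecutive point probabilities offsets the factor `1 / √h` in the central one,
so only the constant `1 / 2` is lost. -/
theorem half_mul_pow_le_fairCoinMeasure {h k s : ℕ} (hh : 1 ≤ h) (hs : √(h : ℝ) ≤ s)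
    (hks : k + s ≤ h) :
    1 / 2 * (1 - ((k + s : ℕ) : ℝ) / h) ^ (k + s) ≤
      fairCoinMeasure.real {X | h + k ≤ onesCount X (2 * h)} := by
  have hh0 : (0 : ℝ) < h := by exact_mod_cast hh
  have hsub : (⋃ i ∈ Finset.range s, {X | onesCount X (2 * h) = h + (k + i)}) ⊆
      {X | h + k ≤ onesCount X (2 * h)} := by
    intro X hX
    simp only [Finset.mem_range, Set.mem_iUnion, Set.mem_ofPred_eq] at hX ⊢
    omega
  refine le_trans ?_ (measureReal_mono hsub)
  rw [measureReal_biUnion_finset]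
  rotate_left
  · intro i _ j _ hij
    refine Set.disjoint_left.2 fun X hX hX' => hij ?_
    simp only [Set.mem_ofPred_eq] at hX hX'
    omega
  · exact fun i _ => measurable_onesCount _ (measurableSet_singleton (h + (k + i)))
  simp only [fairCoinMeasure_onesCount_eq]
  set x : ℝ := 1 - ((k + s : ℕ) : ℝ) / h with hx
  have hx0 : 0 ≤ x := by
    rw [hx, sub_nonneg, div_le_one hh0]; exact_mod_cast hks
  have hterm (i : ℕ) (hi : i ∈ Finset.range s) :
      h.centralBinom * x ^ (k + s) / 2 ^ (2 * h) ≤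
        ((2 * h).choose (h + (k + i)) : ℝ) / 2 ^ (2 * h) := by
    have hi := Finset.mem_range.1 hi
    refine div_le_div_of_nonneg_right (le_trans ?_
      (centralBinom_mul_le_choose (K := k + i) hh (by omega))) (by positivity)
    gcongr
    have h1 : x ≤ 1 - ((k + i : ℕ) : ℝ) / h := by
      rw [hx]; gcongr
    have h2 : x ≤ 1 := by rw [hx]; simp; positivity
    calc x ^ (k + s) ≤ x ^ (k + i) := pow_le_pow_of_le_one hx0 h2 (by omega)
      _ ≤ _ := by gcongr
  refine le_trans ?_ (Finset.sum_le_sum hterm)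
  rw [Finset.sum_const, Finset.card_range, nsmul_eq_mul]
  have h1 := one_le_two_mul_sqrt_mul_centralBinom_div hh
  have h2 : 1 ≤ 2 * (s : ℝ) * (h.centralBinom / 2 ^ (2 * h)) := by
    refine h1.trans ?_
    gcongr
  have h3 := mul_le_mul_of_nonneg_right h2 (show 0 ≤ x ^ (k + s) / 2 by positivity)
  calc 1 / 2 * x ^ (k + s) = 1 * (x ^ (k + s) / 2) := by ring
    _ ≤ _ := h3
    _ = _ := by ring

theorem exp_neg_div_le_one_sub {x ε : ℝ} (hx0 : 0 ≤ x) (hx : x ≤ ε) (hε : ε < 1) :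
    Real.exp (-(x / (1 - ε))) ≤ 1 - x := by
  have h1 : 0 < 1 - x := by linarith
  rw [← Real.le_log_iff_exp_le h1]
  refine le_trans ?_ (Real.one_sub_inv_le_log_of_pos h1)
  have h2 : x / (1 - x) ≤ x / (1 - ε) := div_le_div_of_nonneg_left hx0 (by linarith) (by linarith)
  have h3 : 1 - (1 - x)⁻¹ = -(x / (1 - x)) := by field_simp; ring
  rw [h3]
  linarith

/-- A lower bound for the tail of the binomial distribution with the sharp exponent. -/
theorem half_mul_exp_le_fairCoinMeasure {h k : ℕ} (hh : 1 ≤ h) {u ε : ℝ}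
    (hk : (k : ℝ) ≤ √(h * u) + 1) (hε : ε < 1) (hu : √u + 3 ≤ ε * √(h : ℝ)) :
    1 / 2 * Real.exp (-((√u + 3) ^ 2 / (1 - ε))) ≤
      fairCoinMeasure.real {X | h + k ≤ onesCount X (2 * h)} := by
  have hh0 : (0 : ℝ) < h := by exact_mod_cast hh
  have hh1 : 1 ≤ √(h : ℝ) := Real.one_le_sqrt.2 (by exact_mod_cast hh)
  have hsq : √(h : ℝ) * √h = h := Real.mul_self_sqrt hh0.le
  set s := ⌈√(h : ℝ)⌉₊ with hs
  have hs1 : (s : ℝ) ≤ √h + 1 := (Nat.ceil_lt_add_one (Real.sqrt_nonneg _)).le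
  rw [Real.sqrt_mul hh0.le] at hk
  -- The two roundings add `2 ≤ 2 * √h` and `s` itself another `√h`, whence the `3`.
  have hK : ((k + s : ℕ) : ℝ) ≤ √h * (√u + 3) := by push_cast; nlinarith
  have hKε : ((k + s : ℕ) : ℝ) ≤ ε * h := by
    calc _ ≤ √h * (√u + 3) := hK
      _ ≤ √h * (ε * √h) := by gcongr
      _ = ε * h := by linear_combination ε * hsq
  have hKh : k + s ≤ h := by
    have : ((k + s : ℕ) : ℝ) ≤ h := hKε.trans (by nlinarith)
    exact_mod_cast this
  refine le_trans ?_ (half_mul_pow_le_fairCoinMeasure hh (Nat.le_ceil _) hKh)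
  gcongr
  have h1 := exp_neg_div_le_one_sub (x := ((k + s : ℕ) : ℝ) / h) (by positivity)
    ((div_le_iff₀ hh0).2 hKε) hε
  refine le_trans ?_ (pow_le_pow_left₀ (Real.exp_nonneg _) h1 _)
  rw [← Real.exp_nat_mul, Real.exp_le_exp]
  have hε' : 0 < 1 - ε := by linarith
  have h2 : ((k + s : ℕ) : ℝ) * (((k + s : ℕ) : ℝ) / h) ≤ (√u + 3) ^ 2 := by
    rw [← mul_div_assoc, div_le_iff₀ hh0]
    calc ((k + s : ℕ) : ℝ) * ((k + s : ℕ) : ℝ) ≤ (√h * (√u + 3)) * (√h * (√u + 3)) := by gcongr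
      _ = _ := by linear_combination (√u + 3) ^ 2 * hsq
  rw [mul_neg, neg_le_neg_iff, ← mul_div_assoc]
  gcongr

theorem natLog_two_mul_log_two_le {j : ℕ} (hj : j ≠ 0) :
    Nat.log 2 j * Real.log 2 ≤ Real.log (j + 1) := by
  rw [← Real.log_pow]
  refine Real.log_le_log (by positivity) ?_
  have := Nat.pow_log_le_self 2 hj
  exact_mod_cast this.trans (Nat.le_succ j)

theorem log_le_natLog_two_add_one_mul (j : ℕ) :
    Real.log (j + 1) ≤ (Nat.log 2 j + 1) * Real.log 2 := by
  have h : Real.log (j + 1) ≤ Real.log (2 ^ (Nat.log 2 j + 1)) := by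
    refine Real.log_le_log (by positivity) ?_
    have := Nat.lt_pow_succ_log_self one_lt_two j
    exact_mod_cast this
  rw [Real.log_pow] at h
  exact_mod_cast h

theorem tendsto_log_natCast_add_one : Tendsto (fun j : ℕ => Real.log (j + 1)) atTop atTop :=
  Real.tendsto_log_atTop.comp (tendsto_atTop_add_const_right _ _ tendsto_natCast_atTop_atTop)

/-- In a block of length `2 * h` with `h ≥ 2 ^ j` the number of ones exceeds `h` by
`√(σ * h * log₂ j)` with probability at least `1 / (j + 1)`. -/
theorem eventually_inv_le_fairCoinMeasure {σ : ℝ} (hσ0 : 0 ≤ σ) (hσ : σ < Real.log 2) :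
    ∀ᶠ j : ℕ in atTop, ∀ h : ℕ, 2 ^ j ≤ h → 1 / ((j : ℝ) + 1) ≤
      fairCoinMeasure.real {X | (h : ℝ) + √(h * (σ * Nat.log 2 j)) ≤ onesCount X (2 * h)} := by
  have hl2 : (0 : ℝ) < Real.log 2 := Real.log_pos one_lt_two
  set τ := σ / Real.log 2 with hτ
  have hτ0 : 0 ≤ τ := by positivity
  have hτ1 : τ < 1 := (div_lt_one hl2).2 hσ
  -- Since `u ≤ τ * v`, the exponent is about `τ / (1 - ε) * v`; this `ε` keeps the factor below `1`
  -- and leaves slack `ε * v` for lower-order terms.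
  set ε := (1 - τ) / 2 with hε
  have hε0 : 0 < ε := by linarith
  have hε1 : ε < 1 := by linarith
  have hε2 : 1 - ε - τ = ε := by linarith
  have hpow : ∀ᶠ j : ℕ in atTop, 16 * (j : ℝ) ≤ ε ^ 2 * 2 ^ j := by
    have h1 := tendsto_pow_const_div_const_pow_of_one_lt 1 (one_lt_two (α := ℝ))
    filter_upwards [h1.eventually (gt_mem_nhds (show (0 : ℝ) < ε ^ 2 / 16 by positivity))] with j hj
    rw [pow_one, div_lt_iff₀ (by positivity)] at hj
    linarith
  filter_upwards [hpow, eventually_ge_atTop 1,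
    tendsto_log_natCast_add_one.eventually_ge_atTop (max 1 ((16 / ε) ^ 2))] with j hj1 hj2 hj3 h hh
  have hj2' : (1 : ℝ) ≤ j := by exact_mod_cast hj2
  have hh1 : 1 ≤ h := Nat.one_le_two_pow.trans hh
  have hhr : (2 : ℝ) ^ j ≤ h := by exact_mod_cast hh
  set v := Real.log (j + 1) with hv
  set u := σ * Nat.log 2 j with hu
  have hu0 : 0 ≤ u := by positivity
  have hv1 : 1 ≤ v := (le_max_left _ _).trans hj3
  have hvj : v ≤ j := by
    have := Real.log_le_sub_one_of_pos (show (0 : ℝ) < j + 1 by positivity)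
    linarith
  have huv : u ≤ τ * v := by
    have h1 := natLog_two_mul_log_two_le (show j ≠ 0 by omega)
    calc u = τ * (Nat.log 2 j * Real.log 2) := by rw [hu, hτ]; field_simp
      _ ≤ τ * v := by gcongr
  have huv' : u ≤ v := huv.trans (by nlinarith)
  have hcond : √u + 3 ≤ ε * √(h : ℝ) := by
    have h1 : √u ≤ √(j : ℝ) := Real.sqrt_le_sqrt (huv'.trans hvj)
    have h2 : 1 ≤ √(j : ℝ) := Real.one_le_sqrt.2 hj2'
    have h3 : 4 * √(j : ℝ) ≤ ε * √(h : ℝ) := by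
      refine (pow_le_pow_iff_left₀ (by positivity) (by positivity) two_ne_zero).1 ?_
      rw [mul_pow, mul_pow, Real.sq_sqrt (by positivity), Real.sq_sqrt (by positivity)]
      have := mul_le_mul_of_nonneg_left hhr (sq_nonneg ε)
      linarith
    linarith
  set k := ⌈√(h * u)⌉₊ with hk
  have hsub : {X | h + k ≤ onesCount X (2 * h)} ⊆
      {X | (h : ℝ) + √(h * u) ≤ onesCount X (2 * h)} := by
    intro X hX
    have h1 : ((h + k : ℕ) : ℝ) ≤ onesCount X (2 * h) := by exact_mod_cast hX
    have h2 := Nat.le_ceil (√(h * u))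
    push_cast at h1
    show (h : ℝ) + √(h * u) ≤ onesCount X (2 * h)
    linarith
  refine le_trans ?_ ((half_mul_exp_le_fairCoinMeasure hh1
    (Nat.ceil_lt_add_one (Real.sqrt_nonneg (h * u))).le hε1 hcond).trans (measureReal_mono hsub))
  have hexp : Real.log 2 + (√u + 3) ^ 2 / (1 - ε) ≤ v := by
    have hw1 : 1 ≤ √v := Real.one_le_sqrt.2 hv1
    -- The lower-order terms total at most `6 * √v + 9 + 1 ≤ 16 * √v ≤ ε * v`.
    have hw2 : 16 / ε ≤ √v := Real.le_sqrt_of_sq_le ((le_max_right _ _).trans hj3)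
    have hw3 : √v ^ 2 = v := Real.sq_sqrt (by linarith)
    have huw : √u ≤ √v := Real.sqrt_le_sqrt huv'
    have hu2 : √u ^ 2 = u := Real.sq_sqrt hu0
    have hlog2 : Real.log 2 ≤ 1 := by have := Real.log_two_lt_d9; linarith
    rw [div_le_iff₀ hε0] at hw2
    have h1 : (√u + 3) ^ 2 ≤ τ * v + 6 * √v + 9 := by nlinarith
    rw [← le_sub_iff_add_le', div_le_iff₀ (by linarith)]
    nlinarith
  calc 1 / ((j : ℝ) + 1) = Real.exp (-v) := by
        rw [Real.exp_neg, hv, Real.exp_log (by positivity), one_div]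
    _ ≤ Real.exp (-Real.log 2 + -((√u + 3) ^ 2 / (1 - ε))) := by
        rw [Real.exp_le_exp]; linarith
    _ = _ := by rw [Real.exp_add, Real.exp_neg, Real.exp_log two_pos]; norm_num

/-! ### The lower half of the law of the iterated logarithm -/

/-- The end of a block of bits whose length `2 * (Q ^ j * (Q - 1))` grows geometrically. -/
def blockEnd (Q j : ℕ) : ℕ := 2 * Q ^ j

theorem blockEnd_succ {Q : ℕ} (hQ : 1 ≤ Q) (j : ℕ) :
    blockEnd Q (j + 1) = blockEnd Q j + 2 * (Q ^ j * (Q - 1)) := by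
  obtain ⟨q, rfl⟩ := Nat.exists_eq_add_of_le' hQ
  simp only [blockEnd, Nat.add_sub_cancel, pow_succ]
  ring

theorem blockEnd_mono {Q : ℕ} (hQ : 1 ≤ Q) : Monotone (blockEnd Q) :=
  fun _ _ h => Nat.mul_le_mul_left 2 (Nat.pow_le_pow_right hQ h)

/-- A block of length `2 * (Q ^ j * (Q - 1))` containing `s` ones has an excess of ones of at
least `√(a / b * Q ^ j * (Q - 1) * log₂ j)`. -/
def IsLargeExcess (Q a b j s : ℕ) : Prop :=
  Q ^ j * (Q - 1) ≤ s ∧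
    a * (Q ^ j * (Q - 1)) * Nat.log 2 j ≤ b * (s - Q ^ j * (Q - 1)) ^ 2

instance (Q a b j s : ℕ) : Decidable (IsLargeExcess Q a b j s) :=
  inferInstanceAs (Decidable (_ ∧ _))

theorem isLargeExcess_iff {Q a b j s : ℕ} (hb : 0 < b) : IsLargeExcess Q a b j s ↔
    ((Q ^ j * (Q - 1) : ℕ) : ℝ) + √((Q ^ j * (Q - 1) : ℕ) * ((a / b : ℝ) * Nat.log 2 j)) ≤ s := by
  set h := Q ^ j * (Q - 1) with hh
  have hb' : (0 : ℝ) < b := by exact_mod_cast hb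
  by_cases hs : h ≤ s
  · have hs' : (h : ℝ) ≤ s := by exact_mod_cast hs
    simp only [IsLargeExcess, ← hh, hs, true_and]
    rw [← le_sub_iff_add_le', Real.sqrt_le_left (by linarith), ← @Nat.cast_le ℝ]
    push_cast [Nat.cast_sub hs]
    rw [show (h : ℝ) * ((a / b : ℝ) * Nat.log 2 j) = (a * h * Nat.log 2 j) / b by ring,
      div_le_iff₀' hb']
  · have hs' : (s : ℝ) < h := by exact_mod_cast not_le.1 hs
    simp only [IsLargeExcess, ← hh, hs, false_and, false_iff, not_le]
    have := Real.sqrt_nonneg ((h : ℝ) * ((a / b : ℝ) * Nat.log 2 j))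
    linarith

/-- The test for the lower half of the law of the iterated logarithm. -/
theorem uniformlySigma01_forall_not_isLargeExcess (Q a b M : ℕ) :
    UniformlySigma01 fun k => {X | ∀ j < M * 2 ^ k, M ≤ j →
      ¬ IsLargeExcess Q a b j (onesCount X (blockEnd Q (j + 1)) - onesCount X (blockEnd Q j))} := by
  -- Membership says that the sum of these indicators vanishes; it is decidable, and the search
  -- variable plays no role.
  let g : ℕ → ℕ → ℕ := fun j s => if M ≤ j ∧ IsLargeExcess Q a b j s then 1 else 0
  have hj : Primrec fun p : ℕ × ℕ => p.1 := Primrec.fst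
  have hh : Primrec fun p : ℕ × ℕ => Q ^ p.1 * (Q - 1) :=
    Primrec.nat_mul.comp (Primrec.nat_pow.comp (Primrec.const Q) hj) (Primrec.const (Q - 1))
  have hg : Primrec₂ g := by
    refine Primrec.ite (PrimrecPred.and ?_ (PrimrecPred.and ?_ ?_)) (Primrec.const 1)
      (Primrec.const 0)
    · exact Primrec.nat_le.comp (Primrec.const M) hj
    · exact Primrec.nat_le.comp hh Primrec.snd
    · exact Primrec.nat_le.comp
        (Primrec.nat_mul.comp (Primrec.nat_mul.comp (Primrec.const a) hh)
          (Primrec.nat_log_two.comp hj))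
        (Primrec.nat_mul.comp (Primrec.const b)
          (Primrec.nat_pow.comp (Primrec.nat_sub.comp Primrec.snd hh) (Primrec.const 2)))
  have hblock : Primrec (blockEnd Q) :=
    Primrec.nat_mul.comp (Primrec.const 2) (Primrec.nat_pow.comp (Primrec.const Q) Primrec.id)
  have hones (f : ℕ → ℕ) (hf : Primrec f) : ComputableFunctional fun X j => onesCount X (f j) :=
    ComputableFunctional.onesCount.comp (ComputableFunctional.of_primrec hf)
  have hsum := ComputableFunctional.sum_range (ComputableFunctional.comp_primrec₂ hg
    (ComputableFunctional.of_primrec Primrec.id)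
    (ComputableFunctional.comp_primrec₂ Primrec.nat_sub
      (hones _ (hblock.comp Primrec.succ)) (hones _ hblock)))
  have hF := (hsum.comp (ComputableFunctional.of_primrec (f := fun m => M * 2 ^ m.unpair.1)
    (Primrec.nat_mul.comp (Primrec.const M) (Primrec.nat_pow.comp (Primrec.const 2)
      (Primrec.fst.comp Primrec.unpair))))).uniformlySigma01
  refine cast (congrArg UniformlySigma01 ?_) hF
  funext k
  ext X
  simp [g]

theorem onesCount_congr {X Y : ℕ → Bool} {n m : ℕ} (h : ∀ i < n, X i = Y i) (hm : m ≤ n) :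
    onesCount X m = onesCount Y m :=
  Finset.sum_congr rfl fun i hi => by rw [h i ((Finset.mem_range.1 hi).trans_le hm)]

/-- Block `R` is independent of the earlier bits and fails with probability at most `R / (R + 1)`;
the product telescopes. -/
theorem fairCoinMeasure_forall_not_isLargeExcess_le {Q a b M : ℕ} (hQ : 1 ≤ Q) (hM : 1 ≤ M)
    (h : ∀ j, M ≤ j → 1 / ((j : ℝ) + 1) ≤
      fairCoinMeasure.real {X | IsLargeExcess Q a b j (onesCount X (2 * (Q ^ j * (Q - 1))))})
    {R : ℕ} (hR : M ≤ R) :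
    fairCoinMeasure.real {X | ∀ j < R, M ≤ j → ¬ IsLargeExcess Q a b j
      (onesCount X (blockEnd Q (j + 1)) - onesCount X (blockEnd Q j))} ≤ M / R := by
  have hM0 : (0 : ℝ) < M := by exact_mod_cast hM
  induction R, hR using Nat.le_induction with
  | base => rw [div_self hM0.ne']; exact measureReal_le_one
  | succ R hR ih =>
    set A : Set (ℕ → Bool) := {X | ∀ j < R, M ≤ j → ¬ IsLargeExcess Q a b j
      (onesCount X (blockEnd Q (j + 1)) - onesCount X (blockEnd Q j))} with hA
    set G : Set (ℕ → Bool) :=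
      {X | IsLargeExcess Q a b R (onesCount X (2 * (Q ^ R * (Q - 1))))} with hG
    have hGm : MeasurableSet G := measurable_onesCount _
      (MeasurableSet.of_discrete (s := {s : ℕ | IsLargeExcess Q a b R s}))
    have hAm : MeasurableSet A := by
      have : A = ⋂ j ∈ Set.Iio R, {X | M ≤ j → ¬ IsLargeExcess Q a b j
          (onesCount X (blockEnd Q (j + 1)) - onesCount X (blockEnd Q j))} := by
        ext X; simp [hA]
      rw [this]
      refine MeasurableSet.biInter (Set.to_countable _) fun j _ => ?_
      exact ((measurable_onesCount (blockEnd Q (j + 1))).sub (measurable_onesCount (blockEnd Q j)))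
        (MeasurableSet.of_discrete (s := {s : ℕ | M ≤ j → ¬ IsLargeExcess Q a b j s}))
    have hset : {X | ∀ j < R + 1, M ≤ j → ¬ IsLargeExcess Q a b j
        (onesCount X (blockEnd Q (j + 1)) - onesCount X (blockEnd Q j))} =
        A ∩ {X | (fun i => X (blockEnd Q R + i)) ∈ Gᶜ} := by
      ext X
      simp only [Set.mem_ofPred_eq, Set.mem_inter_iff, Set.mem_compl_iff, hA, hG,
        Nat.lt_succ_iff_lt_or_eq, or_imp, forall_and, forall_eq]
      rw [blockEnd_succ hQ R, onesCount_add, Nat.add_sub_cancel_left]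
      simp [hR]
    have hGr : fairCoinMeasure.real Gᶜ ≤ R / (R + 1) := by
      rw [probReal_compl_eq_one_sub hGm]
      have := h R hR
      rw [show (R : ℝ) / (R + 1) = 1 - 1 / (R + 1) by field_simp; ring]
      linarith
    rw [hset, fairCoinMeasure_inter_shift _ hAm hGm.compl]
    · have hR0 : (0 : ℝ) < R := hM0.trans_le (by exact_mod_cast hR)
      calc _ ≤ (M / R : ℝ) * (R / (R + 1)) := by gcongr
        _ = _ := by push_cast; field_simp
    · intro X Y hXY hX j hj hMj
      rw [← onesCount_congr hXY (blockEnd_mono hQ hj), ← onesCount_congr hXY (blockEnd_mono hQ hj.le)]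
      exact hX j hj hMj

/-- Effective second Borel–Cantelli lemma: escaping the test begun at an arbitrary `M` produces a
good block beyond `M`. -/
theorem IsMartinLofRandom.frequently_isLargeExcess {X : ℕ → Bool} (hX : IsMartinLofRandom X)
    {Q : ℕ} (hQ : 2 ≤ Q) {σ : ℚ} (hσ0 : 0 < σ) (hσ : σ < Real.log 2) :
    ∃ᶠ j in atTop, IsLargeExcess Q σ.num.toNat σ.den j
      (onesCount X (blockEnd Q (j + 1)) - onesCount X (blockEnd Q j)) := by
  obtain ⟨J, hJ⟩ := eventually_atTop.1
    (eventually_inv_le_fairCoinMeasure (by exact_mod_cast hσ0.le) hσ)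
  rw [frequently_atTop]
  intro M'
  set M := max (max M' J) 1 with hM
  have hM1 : 1 ≤ M := le_max_right _ _
  have hMJ : J ≤ M := (le_max_right _ _).trans (le_max_left _ _)
  have hμ (j : ℕ) (hj : M ≤ j) : 1 / ((j : ℝ) + 1) ≤ fairCoinMeasure.real {X |
      IsLargeExcess Q σ.num.toNat σ.den j (onesCount X (2 * (Q ^ j * (Q - 1))))} := by
    simp only [isLargeExcess_iff σ.den_pos, ← ratCast_eq_toNat_div_den hσ0]
    refine hJ j (hMJ.trans hj) _ ?_
    calc 2 ^ j ≤ Q ^ j := Nat.pow_le_pow_left hQ j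
      _ ≤ Q ^ j * (Q - 1) := Nat.le_mul_of_pos_right _ (by omega)
  obtain ⟨k, hk⟩ := hX.exists_notMem
    (uniformlySigma01_forall_not_isLargeExcess Q σ.num.toNat σ.den M) fun k => by
    rw [← ofReal_measureReal]
    have h1 := fairCoinMeasure_forall_not_isLargeExcess_le (R := M * 2 ^ k) (by omega) hM1 hμ
      (Nat.le_mul_of_pos_right _ (by positivity))
    have hM0 : (0 : ℝ) < M := by exact_mod_cast hM1
    have h2 : (M : ℝ) / ((M * 2 ^ k : ℕ) : ℝ) = (2⁻¹) ^ k := by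
      push_cast
      rw [inv_pow]
      field_simp
    rw [h2] at h1
    refine (ENNReal.ofReal_le_ofReal h1).trans (le_of_eq ?_)
    rw [ENNReal.ofReal_pow (by norm_num), ENNReal.ofReal_inv_of_pos two_pos]
    simp
  simp only [Set.mem_ofPred_eq, not_forall, not_not] at hk
  obtain ⟨j, -, hj, h⟩ := hk
  exact ⟨j, ((le_max_left _ _).trans (le_max_left _ _)).trans hj, h⟩

theorem tendsto_blockEnd {Q : ℕ} (hQ : 2 ≤ Q) : Tendsto (blockEnd Q) atTop atTop := by
  have h := tendsto_pow_atTop_atTop_of_one_lt (show 1 < Q by omega)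
  exact tendsto_atTop_mono (fun j => Nat.le_mul_of_pos_left _ two_pos) h

/-- The iterated logarithm of the block end is at most `log (j + 1)` plus a constant, absorbed by `σ
/ log 2 - τ > 0`. -/
theorem eventually_log_log_blockEnd_le {Q : ℕ} (hQ : 2 ≤ Q) {σ τ : ℝ} (hτ : 0 ≤ τ)
    (h : τ * Real.log 2 < σ) :
    ∀ᶠ j : ℕ in atTop, τ * Real.log (Real.log (blockEnd Q (j + 1))) ≤ σ * Nat.log 2 j := by
  have hl2 : (0 : ℝ) < Real.log 2 := Real.log_pos one_lt_two
  have hσ : 0 < σ := lt_of_le_of_lt (by positivity) h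
  have hQ' : (2 : ℝ) ≤ Q := by exact_mod_cast hQ
  have hlQ : 0 < Real.log Q := Real.log_pos (by linarith)
  set c := Real.log (Real.log Q + Real.log 2) with hc
  have hη : 0 < σ / Real.log 2 - τ := by
    rw [sub_pos, lt_div_iff₀ hl2]; exact h
  filter_upwards [tendsto_log_natCast_add_one.eventually_ge_atTop
    ((σ + τ * c) / (σ / Real.log 2 - τ))] with j hj
  rw [div_le_iff₀ hη] at hj
  have h1 : Real.log (Real.log (blockEnd Q (j + 1))) ≤ Real.log (j + 1) + c := by
    rw [hc, ← Real.log_mul (by positivity) (by positivity)]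
    have e : Real.log (blockEnd Q (j + 1)) = (j + 1) * Real.log Q + Real.log 2 := by
      rw [blockEnd]
      push_cast
      rw [Real.log_mul two_ne_zero (by positivity), Real.log_pow]
      push_cast
      ring
    rw [e]
    refine Real.log_le_log (by positivity) ?_
    have : 0 ≤ (j : ℝ) * Real.log 2 := by positivity
    nlinarith
  have h2 := mul_le_mul_of_nonneg_left (log_le_natLog_two_add_one_mul j)
    (show 0 ≤ σ / Real.log 2 by positivity)
  have h3 : σ / Real.log 2 * ((Nat.log 2 j + 1) * Real.log 2) = σ * Nat.log 2 j + σ := by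
    field_simp
  have h4 := mul_le_mul_of_nonneg_left h1 hτ
  nlinarith

/-- For large `Q` the last block is nearly the whole prefix (`1 - 1 / Q`), and the possible deficit
`2 * √(1 / Q)` of the bits before it is negligible. -/
theorem exists_lt_sqrt_sub_div {l τ : ℝ} (h : l < √τ) :
    ∃ Q : ℕ, 2 ≤ Q ∧ l < √((1 - 1 / (Q : ℝ)) * τ) - 2 * √(1 / (Q : ℝ)) := by
  have h0 : Tendsto (fun Q : ℕ => 1 / (Q : ℝ)) atTop (nhds 0) :=
    tendsto_one_div_atTop_nhds_zero_nat
  have h1 : Tendsto (fun Q : ℕ => √((1 - 1 / (Q : ℝ)) * τ) - 2 * √(1 / (Q : ℝ))) atTop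
      (nhds (√((1 - 0) * τ) - 2 * √0)) :=
    (((h0.const_sub 1).mul_const τ).sqrt).sub (h0.sqrt.const_mul 2)
  rw [Real.sqrt_zero, mul_zero, sub_zero, sub_zero, one_mul] at h1
  obtain ⟨Q, hQ, hQ2⟩ := ((h1.eventually (lt_mem_nhds h)).and (eventually_ge_atTop 2)).exists
  exact ⟨Q, hQ2, hQ⟩

theorem IsMartinLofRandom.frequently_lt_onesCount {X : ℕ → Bool} (hX : IsMartinLofRandom X)
    {l : ℝ} (hl : l < 1) :
    ∃ᶠ n : ℕ in atTop, (n : ℝ) / 2 + l * lilScale n < onesCount X n := by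
  have hl2 : (0 : ℝ) < Real.log 2 := Real.log_pos one_lt_two
  set t := (1 + max l 0) / 2 with ht
  have ht0 : 0 < t := by have := le_max_right l 0; linarith
  have ht1 : t < 1 := by have := max_lt hl one_pos; linarith
  have hlt : l < √(t ^ 2) := by
    rw [Real.sqrt_sq ht0.le]
    have := le_max_left l 0
    linarith
  obtain ⟨Q, hQ, hlQ⟩ := exists_lt_sqrt_sub_div hlt
  obtain ⟨σ, hσ1, hσ2⟩ := exists_rat_btwn (show t ^ 2 * Real.log 2 < Real.log 2 by
    nlinarith [mul_pos hl2 (sub_pos.2 ht1)])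
  have hσ0 : (0 : ℝ) < σ := lt_of_le_of_lt (by positivity) hσ1
  have hσ0' : 0 < σ := by exact_mod_cast hσ0
  have hQ0 : (0 : ℝ) < Q := by exact_mod_cast (show 0 < Q by omega)
  have hQ1 : (1 : ℝ) < Q := by exact_mod_cast (show 1 < Q by omega)
  have hends := tendsto_blockEnd hQ
  have hends' : Tendsto (fun j => blockEnd Q (j + 1)) atTop atTop :=
    hends.comp (tendsto_add_atTop_nat 1)
  refine hends'.frequently ?_
  refine ((hX.frequently_isLargeExcess hQ hσ0' hσ2).and_eventually
    ((eventually_log_log_blockEnd_le hQ (sq_nonneg t) hσ1).and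
      -- The upper half for the flipped sequence with constant `2`: the first `n` bits of `X` fall
      -- short of `n / 2` by at most `2 * lilScale n`.
      ((hends.eventually (hX.not.eventually_onesCount_le one_lt_two)).and
        (hends.eventually (tendsto_log_log_natCast.eventually_ge_atTop 1))))).mono ?_
  rintro j ⟨h1, h2, h3, h4⟩
  rw [isLargeExcess_iff σ.den_pos, ← ratCast_eq_toNat_div_den hσ0'] at h1
  rw [onesCount_not] at h3
  set n := blockEnd Q j with hn
  set n' := blockEnd Q (j + 1) with hn'
  have hnn' : n ≤ n' := blockEnd_mono (by omega) (Nat.le_succ j)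
  have hn0 : 1 ≤ n := Nat.mul_pos two_pos (Nat.pow_pos (by omega))
  have hS : onesCount X n ≤ onesCount X n' := by
    rw [hn', blockEnd_succ (by omega), onesCount_add]
    exact Nat.le_add_right _ _
  rw [Nat.cast_sub hS] at h1
  have hlog : 1 ≤ Real.log n := by
    by_contra! hcon
    have : Real.log (Real.log n) ≤ 0 :=
      Real.log_nonpos (Real.log_natCast_nonneg n) hcon.le
    linarith
  have hloglog : Real.log (Real.log n) ≤ Real.log (Real.log n') := by
    refine Real.log_le_log (by linarith) (Real.log_le_log (by exact_mod_cast hn0) ?_)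
    exact_mod_cast hnn'
  set ell := Real.log (Real.log n') with hell
  have e1 : (n : ℝ) = 2 * Q ^ j := by rw [hn, blockEnd]; push_cast; rfl
  have e2 : (n' : ℝ) = 2 * Q ^ (j + 1) := by rw [hn', blockEnd]; push_cast; rfl
  have e3 : ((Q ^ j * (Q - 1) : ℕ) : ℝ) = n' / 2 - n / 2 := by
    rw [e1, e2]
    push_cast [Nat.cast_sub (show 1 ≤ Q by omega)]
    ring
  have e4 : (n : ℝ) / 2 = 1 / Q * (n' / 2) := by rw [e1, e2]; field_simp; ring
  have hz : 0 < lilScale n' := by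
    refine Real.sqrt_pos.2 (mul_pos ?_ (by linarith))
    rw [e2]; positivity
  have hb1 : lilScale n ≤ √(1 / (Q : ℝ)) * lilScale n' := by
    rw [lilScale, lilScale, ← Real.sqrt_mul (by positivity), e4]
    refine Real.sqrt_le_sqrt ?_
    rw [mul_assoc]
    gcongr
  have hb2 : √((1 - 1 / (Q : ℝ)) * t ^ 2) * lilScale n' ≤
      √((Q ^ j * (Q - 1) : ℕ) * (σ * Nat.log 2 j)) := by
    have hq : 0 ≤ 1 - 1 / (Q : ℝ) := by
      rw [sub_nonneg, div_le_one hQ0]; exact hQ1.le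
    rw [lilScale, ← Real.sqrt_mul (by positivity), e3, e4]
    refine Real.sqrt_le_sqrt ?_
    calc (1 - 1 / (Q : ℝ)) * t ^ 2 * (n' / 2 * ell)
        = ((1 - 1 / (Q : ℝ)) * (n' / 2)) * (t ^ 2 * ell) := by ring
      _ ≤ ((1 - 1 / (Q : ℝ)) * (n' / 2)) * (σ * Nat.log 2 j) := by gcongr
      _ = _ := by ring
  rw [e3] at h1 hb2
  have hfin := mul_lt_mul_of_pos_right hlQ hz
  rw [sub_mul] at hfin
  linarith

/-! ### The law of the iterated logarithm -/

theorem eventually_lilScale_pos : ∀ᶠ n : ℕ in atTop, 0 < lilScale n := by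
  filter_upwards [tendsto_log_log_natCast.eventually_gt_atTop 0, eventually_gt_atTop 0]
    with n h1 h2
  have : (0 : ℝ) < n := by exact_mod_cast h2
  exact Real.sqrt_pos.2 (by positivity)

theorem limsup_coe_eq_one {u : ℕ → ℝ} (h1 : ∀ l : ℝ, 1 < l → ∀ᶠ n in atTop, u n ≤ l)
    (h2 : ∀ l : ℝ, l < 1 → ∃ᶠ n in atTop, l < u n) :
    limsup (fun n => (u n : EReal)) atTop = 1 := by
  refine le_antisymm (EReal.le_of_forall_lt_iff_le.1 fun z hz => ?_)
    (EReal.ge_of_forall_gt_iff_ge.1 fun z hz => ?_)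
  · have hz' : 1 < z := by exact_mod_cast hz
    exact limsup_le_of_le (by isBoundedDefault)
      ((h1 z hz').mono fun n hn => EReal.coe_le_coe_iff.2 hn)
  · have hz' : z < 1 := by exact_mod_cast hz
    exact le_limsup_of_frequently_le
      ((h2 z hz').mono fun n hn => EReal.coe_le_coe_iff.2 hn.le) (by isBoundedDefault)

namespace IsMartinLofRandom

theorem eventually_div_lilScale_le {X : ℕ → Bool} (hX : IsMartinLofRandom X) {l : ℝ}
    (hl : 1 < l) : ∀ᶠ n : ℕ in atTop, ((onesCount X n : ℝ) - n / 2) / lilScale n ≤ l := by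
  filter_upwards [hX.eventually_onesCount_le hl, eventually_lilScale_pos] with n h1 h2
  rw [div_le_iff₀ h2]
  linarith

theorem frequently_lt_div_lilScale {X : ℕ → Bool} (hX : IsMartinLofRandom X) {l : ℝ}
    (hl : l < 1) : ∃ᶠ n : ℕ in atTop, l < ((onesCount X n : ℝ) - n / 2) / lilScale n := by
  refine ((hX.frequently_lt_onesCount hl).and_eventually eventually_lilScale_pos).mono ?_
  rintro n ⟨h1, h2⟩
  rw [lt_div_iff₀ h2]
  linarith

theorem limsup_div_lilScale {X : ℕ → Bool} (hX : IsMartinLofRandom X) :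
    limsup (fun n : ℕ =>
      ((((onesCount X n : ℝ) - (n : ℝ) / 2) / lilScale n : ℝ) : EReal)) atTop = 1 :=
  limsup_coe_eq_one (fun _ => hX.eventually_div_lilScale_le)
    fun _ => hX.frequently_lt_div_lilScale

end IsMartinLofRandom

theorem onesCount_not_sub_div (X : ℕ → Bool) (n : ℕ) :
    ((onesCount (fun i => !X i) n : ℝ) - n / 2) / lilScale n =
      -(((onesCount X n : ℝ) - n / 2) / lilScale n) := by
  rw [onesCount_not]
  ring

theorem mainTheorem1 (X : ℕ → Bool) (hX : IsMartinLofRandom X) :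
    limsup (fun n : ℕ =>
        ((((onesCount X n : ℝ) - (n : ℝ) / 2) / lilScale n : ℝ) : EReal)) atTop = 1 ∧
    (∀ l : ℝ, 1 < l → ∃ N : ℕ, ∀ n : ℕ, N < n →
        (onesCount X n : ℝ) ≤ (n : ℝ) / 2 + l * lilScale n) ∧
    (∀ l : ℝ, l < 1 →
        {n : ℕ | (n : ℝ) / 2 + l * lilScale n < (onesCount X n : ℝ)}.Infinite) ∧
    IsMartinLofRandom (fun i => !(X i)) ∧
    liminf (fun n : ℕ =>
        ((((onesCount X n : ℝ) - (n : ℝ) / 2) / lilScale n : ℝ) : EReal)) atTop = -1 ∧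
    limsup (fun n : ℕ =>
        ((|(onesCount X n : ℝ) - (n : ℝ) / 2| / lilScale n : ℝ) : EReal)) atTop = 1 := by
  refine ⟨hX.limsup_div_lilScale, fun l hl => ?_, fun l hl => ?_, hX.not, ?_, ?_⟩
  · obtain ⟨N, hN⟩ := eventually_atTop.1 (hX.eventually_onesCount_le hl)
    exact ⟨N, fun n hn => hN n hn.le⟩
  · exact Nat.frequently_atTop_iff_infinite.1 (hX.frequently_lt_onesCount hl)
  -- Flipping negates the normalized excess, turning the limsup into the negated liminf.
  · have h := hX.not.limsup_div_lilScale
    simp only [onesCount_not_sub_div, EReal.coe_neg] at h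
    have h' := EReal.limsup_neg (f := atTop)
      (v := fun n : ℕ => ((((onesCount X n : ℝ) - (n : ℝ) / 2) / lilScale n : ℝ) : EReal))
    rw [← neg_inj, ← h', neg_neg]
    exact h
  · refine limsup_coe_eq_one (fun l hl => ?_) fun l hl => ?_
    · filter_upwards [hX.eventually_div_lilScale_le hl, hX.not.eventually_div_lilScale_le hl]
        with n h1 h2
      rw [onesCount_not_sub_div] at h2
      have h3 : |lilScale n| = lilScale n := abs_of_nonneg (Real.sqrt_nonneg _)
      rw [← h3, ← abs_div]
      exact abs_le.2 ⟨by linarith, h1⟩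
    · refine (hX.frequently_lt_div_lilScale hl).mono fun n hn => hn.trans_le ?_
      exact div_le_div_of_nonneg_right (le_abs_self _) (Real.sqrt_nonneg _)
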